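/- For $n\ge 1$ let $S^d(\mathbb C^n)=\mathbb C[X_1,\dots,X_n]_d$ be the space of forms of degree $d$, let $\iota:\mathbb P(S^2(\mathbb C^n))\to\mathbb P(S^6(\mathbb C^n))$ be the map $[p]\mapsto[p^3]$, and let $V=V_{2,3}$ be its image, the variety of cubes of quadratic forms. The binomial set is $$\mathcal B_n=\{(X_i+X_j)^2 \mid 1\le i<j\le n\}\cup\{X_1^2\}\subseteq S^2(\mathbb C^n).$$ For a projective variety $W\subseteq\mathbb P^N$ and points $x_1,\dots,x_m\in W$ let $$\Gamma_W(x_1,\dots,x_m)=\Big\{y\in W \ \Big|\ T_yW\subseteq\sum_{i=1}^m T_{x_i}W\Big\},$$ where $T_yW$ is the embedded projective tangent space (the Zariski tangent space of the affine cone of $W$, as a linear subspace), and let the tangential contact locus $\mathcal C_W(x_1,\dots,x_m)$ be the union of the irreducible components of $\Gamma_W(x_1,\dots,x_m)$ that contain at least one of the $x_i$. For nonzero quadratic forms $q_1,\dots,q_m$ let the affine tangential contact locus $\widehat{\mathcal C}(q_1,\dots,q_m)\subseteq S^2(\mathbb C^n)$ be the affine cone (including the origin) of $\iota^{-1}\big(\mathcal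 C_V([q_1^3],\dots,[q_m^3])\big)$. **Theorem.** Let $n\ge 1$. Then $\mathcal B_n$ has exactly $m=\binom n2+1$ elements. Write $\mathcal B_n=\{q_1,\dots,q_m\}$. 1. For every $q\in\mathcal B_n$ there is a Zariski-open neighbourhood $U\subseteq S^2(\mathbb C^n)$ of $q$ such that $$U\cap\widehat{\mathcal C}(q_1,\dots,q_m)\subseteq\mathbb C\cdot q .$$ 2. The points $[q_1^3],\dots,[q_m^3]$ lie on the contact locus $\mathcal C_V([q_1^3],\dots,[q_m^3])$, and this locus has local dimension zero at each of its points, in particular at each $[q_i^3]$. (The local dimension at a point is the minimal Krull dimension of a Zariski-open neighbourhood of the point in the locus.) -/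

import Mathlib

open scoped LinearAlgebra.Projectivization Topology

namespace ContactLocus

/-! ### Polynomial functions and Zariski topologies -/

section General

/-- Polynomial functions on a complex vector space `E`: the algebra of functions generated by the
linear functionals. -/
def polyFun (E : Type*) [AddCommGroup E] [Module ℂ E] : Subalgebra ℂ (E → ℂ) :=
  Algebra.adjoin ℂ (Set.range fun φ : Module.Dual ℂ E => (φ : E → ℂ))

/-- The Zariski topology on the affine space `E`. -/
@[reducible]
def affineZariski (E : Type*) [AddCommGroup E] [Module ℂ E] : TopologicalSpace E :=
  TopologicalSpace.generateFrom {U | ∃ f ∈ polyFun E, U = {x | f x ≠ 0}}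

/-- The Zariski topology on the projective space `ℙ(E)`: a basis of open sets is given by the
non-vanishing loci of homogeneous polynomial functions. -/
instance projectiveZariski (E : Type*) [AddCommGroup E] [Module ℂ E] :
    TopologicalSpace (ℙ ℂ E) :=
  TopologicalSpace.generateFrom
    {U | ∃ f ∈ polyFun E, ∃ k : ℕ, (∀ (c : ℂ) (x : E), f (c • x) = c ^ k * f x) ∧
      U = {p | f p.rep ≠ 0}}

variable {E : Type*} [AddCommGroup E] [Module ℂ E]

/-- The affine cone over a subset of `ℙ(E)`, including the origin. -/
def affineCone (Z : Set (ℙ ℂ E)) : Set E :=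
  {v | v = 0 ∨ ∃ hv : v ≠ 0, Projectivization.mk ℂ v hv ∈ Z}

/-- A polynomial function has a (linear) differential at every point. -/
theorem polyFun_hasDerivAt {f : E → ℂ} (hf : f ∈ polyFun E) (x : E) :
    ∃ L : Module.Dual ℂ E, ∀ v : E, HasDerivAt (fun t : ℂ => f (x + t • v)) (L v) 0 := by
  induction hf using Algebra.adjoin_induction with
  | mem f hf =>
    obtain ⟨φ, rfl⟩ := hf
    refine ⟨φ, fun v => ?_⟩
    have h : HasDerivAt (fun t : ℂ => φ x + t * φ v) (1 * φ v) 0 :=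
      ((hasDerivAt_id (0 : ℂ)).mul_const (φ v)).const_add (φ x)
    simpa using h
  | algebraMap r => exact ⟨0, fun v => by simpa using hasDerivAt_const (0 : ℂ) r⟩
  | add f g _ _ hf hg =>
    obtain ⟨L, hL⟩ := hf
    obtain ⟨M, hM⟩ := hg
    exact ⟨L + M, fun v => (hL v).add (hM v)⟩
  | mul f g _ _ hf hg =>
    obtain ⟨L, hL⟩ := hf
    obtain ⟨M, hM⟩ := hg
    refine ⟨g x • L + f x • M, fun v => ?_⟩
    have h := (hL v).mul (hM v)
    have e : (g x • L + f x • M) v = L v * g (x + (0 : ℂ) • v) + f (x + (0 : ℂ) • v) * M v := by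
      simp only [LinearMap.add_apply, LinearMap.smul_apply, smul_eq_mul, zero_smul, add_zero]
      ring
    rw [e]
    exact h

/-- The Zariski tangent space at `x` of a subset `W` of the affine space `E`: the common kernel of
the differentials at `x` of all polynomial functions vanishing on `W`. -/
def zariskiTangent (W : Set E) (x : E) : Submodule ℂ E where
  carrier := {v | ∀ f ∈ polyFun E, (∀ y ∈ W, f y = 0) → deriv (fun t : ℂ => f (x + t • v)) 0 = 0}
  zero_mem' := fun f _ _ => by simp
  add_mem' := fun {u v} hu hv f hf hW => by
    obtain ⟨L, hL⟩ := polyFun_hasDerivAt hf x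
    have h1 := hu f hf hW
    have h2 := hv f hf hW
    rw [(hL _).deriv] at h1 h2 ⊢
    rw [map_add, h1, h2, add_zero]
  smul_mem' := fun c v hv f hf hW => by
    obtain ⟨L, hL⟩ := polyFun_hasDerivAt hf x
    have h1 := hv f hf hW
    rw [(hL _).deriv] at h1 ⊢
    rw [map_smul, h1, smul_zero]

/-- The embedded projective tangent space `T_y W` of `W ⊆ ℙ(E)` at `y`, as a linear subspace of
`E`: the tangent space of the affine cone of `W` at a representative of `y`. -/
noncomputable def embeddedTangent (W : Set (ℙ ℂ E)) (y : ℙ ℂ E) : Submodule ℂ E :=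
  zariskiTangent (affineCone W) y.rep

/-- `Γ_W(x)`: the points of `W` whose tangent space lies in the sum of the tangent spaces at the
points `x i`. -/
def tangentialGamma {I : Type*} (W : Set (ℙ ℂ E)) (x : I → ℙ ℂ E) : Set (ℙ ℂ E) :=
  {y | y ∈ W ∧ embeddedTangent W y ≤ ⨆ i, embeddedTangent W (x i)}

/-- The tangential contact locus `C_W(x)`: the union of the irreducible components of `Γ_W(x)`
which contain at least one of the points `x i`. -/
def contactLocus {I : Type*} (W : Set (ℙ ℂ E)) (x : I → ℙ ℂ E) : Set (ℙ ℂ E) :=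
  {z | ∃ K ∈ irreducibleComponents (tangentialGamma W x),
    z ∈ Subtype.val '' K ∧ ∃ i, x i ∈ Subtype.val '' K}

end General

/-- The local dimension of a subset `S` of a topological space at the point `x`: the least Krull
dimension of `U ∩ S`, where `U` ranges over the open neighbourhoods of `x`. -/
noncomputable def localDim {T : Type*} [TopologicalSpace T] (S : Set T) (x : T) : WithBot ℕ∞ :=
  ⨅ U : {U : Set T // IsOpen U ∧ x ∈ U}, topologicalKrullDim ↥(U.1 ∩ S)

/-! ### Powers of forms -/

/-- The space `S^d(ℂ^n)` of forms of degree `d` in `n` variables. -/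
abbrev Forms (n d : ℕ) : Type := MvPolynomial.homogeneousSubmodule (Fin n) ℂ d

/-- The `d`-th power of a form of degree `k`. -/
noncomputable def powForm {n k : ℕ} (d : ℕ) (p : Forms n k) : Forms n (k * d) :=
  ⟨(p : MvPolynomial (Fin n) ℂ) ^ d,
    (MvPolynomial.mem_homogeneousSubmodule _ _).2
      (((MvPolynomial.mem_homogeneousSubmodule _ _).1 p.2).pow d)⟩

theorem powForm_ne_zero {n k : ℕ} (d : ℕ) {p : Forms n k} (hp : p ≠ 0) : powForm d p ≠ 0 := by
  intro h
  have h' : (p : MvPolynomial (Fin n) ℂ) ^ d = 0 := congrArg Subtype.val h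
  exact pow_ne_zero d (fun h0 => hp (Subtype.ext h0)) h'

/-- The map `ι : ℙ(S^k(ℂ^n)) → ℙ(S^{kd}(ℂ^n))`, `[p] ↦ [p^d]`. -/
noncomputable def powMap (n k d : ℕ) : ℙ ℂ (Forms n k) → ℙ ℂ (Forms n (k * d)) :=
  Projectivization.lift
    (fun p => Projectivization.mk ℂ (powForm d p.1) (powForm_ne_zero d p.2))
    (fun a b t h => by
      rw [Projectivization.mk_eq_mk_iff']
      refine ⟨t ^ d, Subtype.ext ?_⟩
      have h' : (a.1 : MvPolynomial (Fin n) ℂ) = t • (b.1 : MvPolynomial (Fin n) ℂ) :=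
        congrArg Subtype.val h
      change t ^ d • (b.1 : MvPolynomial (Fin n) ℂ) ^ d = (a.1 : MvPolynomial (Fin n) ℂ) ^ d
      rw [h', smul_pow])

/-- The variety `V_{k,d}` of `d`-th powers of forms of degree `k` in `n` variables. -/
def powVariety (n k d : ℕ) : Set (ℙ ℂ (Forms n (k * d))) := Set.range (powMap n k d)

/-- For nonzero quadratic forms `q i`, the tangential contact locus of `V_{2,3}` at the points
`[q i ^ 3]`. -/
noncomputable def cubeContactLocus {n : ℕ} {I : Type*} (q : I → Forms n 2) (hq : ∀ i, q i ≠ 0) :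
    Set (ℙ ℂ (Forms n (2 * 3))) :=
  contactLocus (powVariety n 2 3)
    (fun i => powMap n 2 3 (Projectivization.mk ℂ (q i) (hq i)))

/-- The affine tangential contact locus: the affine cone of the preimage under `ι` of the
tangential contact locus at the points `[q i ^ 3]`. -/
noncomputable def affineContactLocus {n : ℕ} {I : Type*} (q : I → Forms n 2)
    (hq : ∀ i, q i ≠ 0) : Set (Forms n 2) :=
  affineCone (powMap n 2 3 ⁻¹' cubeContactLocus q hq)

/-! ### The binomial set -/

/-- The binomial set: the forms `(X_i + X_j)^2` for `i < j`, together with the square of the first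
variable. -/
def binomialSet (n : ℕ) [NeZero n] : Set (Forms n 2) :=
  {q | (∃ i j : Fin n, i < j ∧
      (q : MvPolynomial (Fin n) ℂ) = (MvPolynomial.X i + MvPolynomial.X j) ^ 2) ∨
    (q : MvPolynomial (Fin n) ℂ) = MvPolynomial.X 0 ^ 2}

theorem binomialSet_ne_zero {n : ℕ} [NeZero n] (q : binomialSet n) : (q : Forms n 2) ≠ 0 := by
  intro h
  have h0 : MvPolynomial.eval (fun _ => (1 : ℂ)) (q.1 : MvPolynomial (Fin n) ℂ) = 0 := by
    rw [h]; simp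
  rcases q.2 with ⟨i, j, -, hq⟩ | hq
  · rw [hq] at h0
    norm_num at h0
  · rw [hq] at h0
    norm_num at h0

end ContactLocus

open ContactLocus

namespace ContactLocus

open MvPolynomial

/-! ### The cone over the variety of powers -/

/-! The tangent space of the variety of cubes at `[p ^ 3]` is `p ^ 2 * S^2`, proved by the two
lemmas `mul_mem_zariskiTangent_cube` and `exists_eq_mul_of_mem_zariskiTangent_cube`. Scale the
linear forms behind the binomial set to take the value 2 at `(1, …, 1)`. For nonzero indices `j`,
`k`, each of them then vanishes at exactly one of the vectors `a = testDir j k`, `b = testBase j k`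
(`IsBinomialWeight.test`). In the coordinates `s`, `t` of the plane spanned by `a` and `b`, every `q
i` becomes a multiple of `s ^ 2` or of `t ^ 2`, so all of `q i ^ 2 * S^2` has zero coefficient at `s
^ 3 * t ^ 3`. This coefficient is a linear functional that kills the sum of the tangent spaces. If
`[p ^ 3]` lies in `Γ`, the functional kills `p ^ 2 * S^2`, which forces `p` to restrict to a
multiple of `s ^ 2` or `t ^ 2` as well. Near `q`, nonvanishing at finitely many test vectors decides
which of the two occurs on each plane. The resulting linear conditions leave only the multiples of
`q` (`exists_eq_smul_sq`). Hence each `[q i ^ 3]` is isolated in `Γ`, and topology gives the rest: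
the contact locus consists of these points. -/

theorem powForm_smul {n k d : ℕ} (c : ℂ) (p : Forms n k) :
    powForm d (c • p) = c ^ d • powForm d p :=
  Subtype.ext (smul_pow c (p : MvPolynomial (Fin n) ℂ) d)

theorem exists_smul_powForm {n k d : ℕ} (hd : d ≠ 0) (c : ℂ) (p : Forms n k) :
    ∃ e : ℂ, e ^ d = c ∧ c • powForm d p = powForm d (e • p) := by
  obtain ⟨e, he⟩ := IsAlgClosed.exists_pow_nat_eq c (Nat.pos_of_ne_zero hd)
  exact ⟨e, he, by rw [powForm_smul, he]⟩

theorem powMap_mk {n k d : ℕ} {p : Forms n k} (hp : p ≠ 0) :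
    powMap n k d (Projectivization.mk ℂ p hp) =
      Projectivization.mk ℂ (powForm d p) (powForm_ne_zero d hp) :=
  rfl

theorem powForm_mem_affineCone {n k d : ℕ} (hd : d ≠ 0) (p : Forms n k) :
    powForm d p ∈ affineCone (powVariety n k d) := by
  by_cases hp : p = 0
  · exact Or.inl (Subtype.ext (by simp [powForm, hp, hd]))
  · exact Or.inr ⟨powForm_ne_zero d hp, Projectivization.mk ℂ p hp, powMap_mk hp⟩

theorem exists_eq_powForm {n k d : ℕ} (hd : d ≠ 0) {v : Forms n (k * d)}
    (hv : v ∈ affineCone (powVariety n k d)) : ∃ p : Forms n k, v = powForm d p := by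
  rcases hv with rfl | ⟨hv, z, hz⟩
  · exact ⟨0, Subtype.ext (by simp [powForm, hd])⟩
  · induction z using Projectivization.ind with
    | h p hp =>
      rw [powMap_mk hp, Projectivization.mk_eq_mk_iff'] at hz
      obtain ⟨c, hc⟩ := hz
      obtain ⟨e, he, h⟩ := exists_smul_powForm hd c⁻¹ p
      refine ⟨e • p, ?_⟩
      have hc0 : c ≠ 0 := by
        rintro rfl
        exact powForm_ne_zero d hp (by rw [← hc, zero_smul])
      rw [← h, ← hc, smul_smul, inv_mul_cancel₀ hc0, one_smul]

/-- The chosen representative is known only up to a scalar; a `d`-th root of that scalar can be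
absorbed into `p`. -/
theorem rep_powMap_mk {n k d : ℕ} (hd : d ≠ 0) {p : Forms n k} (hp : p ≠ 0) :
    ∃ c : ℂ, c ≠ 0 ∧ (powMap n k d (Projectivization.mk ℂ p hp)).rep = powForm d (c • p) := by
  obtain ⟨a, ha⟩ := Projectivization.exists_smul_eq_mk_rep ℂ (powForm d p) (powForm_ne_zero d hp)
  obtain ⟨e, he, h⟩ := exists_smul_powForm hd (a : ℂ) p
  refine ⟨e, ?_, by rw [powMap_mk hp, ← ha, ← h]; rfl⟩
  rintro rfl
  rw [zero_pow hd] at he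
  exact a.ne_zero he.symm

/-! ### The tangent spaces of the variety of cubes -/

/-- Evaluation of forms at a point, as a linear functional. -/
noncomputable def evalForm {n d : ℕ} (x : Fin n → ℂ) : Module.Dual ℂ (Forms n d) :=
  (aeval x : MvPolynomial (Fin n) ℂ →ₐ[ℂ] ℂ).toLinearMap ∘ₗ Submodule.subtype _

theorem evalForm_apply {n d : ℕ} (x : Fin n → ℂ) (F : Forms n d) :
    evalForm x F = eval x (F : MvPolynomial (Fin n) ℂ) := by
  simp [evalForm, aeval_eq_eval]

/-- The linear form with coefficients the first partial derivatives at `a`. -/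
noncomputable def jetOne {n : ℕ} (a : Fin n → ℂ) :
    MvPolynomial (Fin n) ℂ →ₗ[ℂ] MvPolynomial (Fin n) ℂ :=
  ∑ i, (LinearMap.toSpanSingleton ℂ _ (X i)) ∘ₗ (aeval a).toLinearMap ∘ₗ (pderiv i).toLinearMap

/-- The quadratic form with coefficients the second partial derivatives at `a`. -/
noncomputable def jetTwo {n : ℕ} (a : Fin n → ℂ) :
    MvPolynomial (Fin n) ℂ →ₗ[ℂ] MvPolynomial (Fin n) ℂ :=
  ∑ i, ∑ j, (LinearMap.toSpanSingleton ℂ _ (X i * X j)) ∘ₗ (aeval a).toLinearMap ∘ₗ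
    (pderiv j).toLinearMap ∘ₗ (pderiv i).toLinearMap

variable {n : ℕ} (a x : Fin n → ℂ)

theorem jetOne_isHomogeneous (F : MvPolynomial (Fin n) ℂ) : (jetOne a F).IsHomogeneous 1 := by
  rw [jetOne, LinearMap.sum_apply]
  refine IsHomogeneous.sum _ _ _ fun i _ => ?_
  simpa [smul_eq_C_mul] using (isHomogeneous_C (Fin n) _).mul (isHomogeneous_X ℂ i)

theorem jetTwo_isHomogeneous (F : MvPolynomial (Fin n) ℂ) : (jetTwo a F).IsHomogeneous 2 := by
  simp only [jetTwo, LinearMap.sum_apply]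
  refine IsHomogeneous.sum _ _ _ fun i _ => IsHomogeneous.sum _ _ _ fun j _ => ?_
  simpa [smul_eq_C_mul] using
    (isHomogeneous_C (Fin n) _).mul ((isHomogeneous_X ℂ i).mul (isHomogeneous_X ℂ j))

theorem eval_jetOne (F : MvPolynomial (Fin n) ℂ) :
    eval x (jetOne a F) = ∑ i, x i * eval a (pderiv i F) := by
  simp [jetOne, aeval_eq_eval, smul_eval, mul_comm]

theorem eval_jetTwo (F : MvPolynomial (Fin n) ℂ) :
    eval x (jetTwo a F) = ∑ i, ∑ j, x i * x j * eval a (pderiv j (pderiv i F)) := by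
  simp [jetTwo, aeval_eq_eval, smul_eval, mul_comm]

/-- The second partials of a quadratic form are constant, so the base point `a` may be replaced by
`x`; then Euler's identity applies twice. -/
theorem eval_jetTwo_of_isHomogeneous {p : MvPolynomial (Fin n) ℂ} (hp : p.IsHomogeneous 2) :
    eval x (jetTwo a p) = 2 * eval x p := by
  have h0 (i j : Fin n) : eval a (pderiv j (pderiv i p)) = eval x (pderiv j (pderiv i p)) := by
    have h : (pderiv j (pderiv i p)).IsHomogeneous 0 := hp.pderiv.pderiv
    rw [← totalDegree_zero_iff_isHomogeneous, totalDegree_eq_zero_iff_eq_C] at h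
    rw [h, eval_C, eval_C]
  have h1 (i : Fin n) : ∑ j, x j * eval x (pderiv j (pderiv i p)) = eval x (pderiv i p) := by
    have h := congrArg (eval x) (hp.pderiv (i := i)).sum_X_mul_pderiv
    simpa using h
  have h2 : ∑ i, x i * eval x (pderiv i p) = 2 * eval x p := by
    have h := congrArg (eval x) hp.sum_X_mul_pderiv
    simpa [two_mul, two_smul] using h
  rw [eval_jetTwo, ← h2]
  refine Finset.sum_congr rfl fun i _ => ?_
  rw [← h1, Finset.mul_sum]
  exact Finset.sum_congr rfl fun j _ => by rw [h0, mul_assoc]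

theorem eval_jetOne_cube (p : MvPolynomial (Fin n) ℂ) :
    eval x (jetOne a (p ^ 3)) = 3 * eval a p ^ 2 * eval x (jetOne a p) := by
  simp only [eval_jetOne, Finset.mul_sum, pderiv_pow]
  refine Finset.sum_congr rfl fun i _ => ?_
  simp
  ring

theorem eval_jetTwo_cube {p : MvPolynomial (Fin n) ℂ} (hp : p.IsHomogeneous 2) :
    eval x (jetTwo a (p ^ 3)) =
      6 * eval a p * eval x (jetOne a p) ^ 2 + 6 * eval a p ^ 2 * eval x p := by
  have h : 6 * eval a p ^ 2 * eval x p = 3 * eval a p ^ 2 * eval x (jetTwo a p) := by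
    rw [eval_jetTwo_of_isHomogeneous a x hp]
    ring
  rw [h, sq (eval x (jetOne a p)), eval_jetOne, Finset.sum_mul_sum, eval_jetTwo, eval_jetTwo]
  simp only [Finset.mul_sum, ← Finset.sum_add_distrib]
  refine Finset.sum_congr rfl fun i _ => Finset.sum_congr rfl fun j _ => ?_
  rw [pow_three]
  simp
  ring

/-- A quadratic form `p` can be recovered from `p ^ 3` on the locus `p a ≠ 0`. -/
theorem eval_jets_cube {p : MvPolynomial (Fin n) ℂ} (hp : p.IsHomogeneous 2) :
    3 * eval a (p ^ 3) * eval x (jetTwo a (p ^ 3)) - 2 * eval x (jetOne a (p ^ 3)) ^ 2 =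
      18 * eval a p ^ 5 * eval x p := by
  rw [eval_jetTwo_cube a x hp, eval_jetOne_cube, map_pow]
  ring

/-! ### Differentiation of polynomial functions and the tangent space at a cube. -/

theorem hasDerivAt_linear {E : Type*} [AddCommGroup E] [Module ℂ E] (φ : Module.Dual ℂ E)
    (v w : E) : HasDerivAt (fun t : ℂ => φ (v + t • w)) (φ w) 0 := by
  have h : HasDerivAt (fun t : ℂ => φ v + t * φ w) (1 * φ w) 0 :=
    ((hasDerivAt_id (0 : ℂ)).mul_const (φ w)).const_add (φ v)
  simpa using h

theorem dual_mem_polyFun {E : Type*} [AddCommGroup E] [Module ℂ E] (φ : Module.Dual ℂ E) :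
    (φ : E → ℂ) ∈ polyFun E :=
  Algebra.subset_adjoin ⟨φ, rfl⟩

/-- The derivative of a polynomial function along a curve depends only on the tangent vector. -/
theorem exists_hasDerivAt_comp {E : Type*} [AddCommGroup E] [Module ℂ E] {f : E → ℂ}
    (hf : f ∈ polyFun E) (x v : E) :
    ∃ L : ℂ, ∀ γ : ℂ → E, γ 0 = x →
      (∀ φ : Module.Dual ℂ E, HasDerivAt (fun t => φ (γ t)) (φ v) 0) →
      HasDerivAt (fun t => f (γ t)) L 0 := by
  induction hf using Algebra.adjoin_induction with
  | mem f hf =>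
    obtain ⟨φ, rfl⟩ := hf
    exact ⟨φ v, fun γ _ h => h φ⟩
  | algebraMap r => exact ⟨0, fun γ _ _ => hasDerivAt_const (0 : ℂ) r⟩
  | add f g _ _ hf hg =>
    obtain ⟨L, hL⟩ := hf
    obtain ⟨M, hM⟩ := hg
    exact ⟨L + M, fun γ h0 h => (hL γ h0 h).add (hM γ h0 h)⟩
  | mul f g _ _ hf hg =>
    obtain ⟨L, hL⟩ := hf
    obtain ⟨M, hM⟩ := hg
    refine ⟨L * g x + f x * M, fun γ h0 h => ?_⟩
    have hd := (hL γ h0 h).mul (hM γ h0 h)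
    simp only [h0] at hd
    exact hd

theorem exists_eval_ne_zero {d : ℕ} {p : Forms n d} (hp : p ≠ 0) :
    ∃ a, eval a (p : MvPolynomial (Fin n) ℂ) ≠ 0 := by
  by_contra! h
  exact hp (Subtype.ext (MvPolynomial.funext fun x => by simpa using h x))

/-- The vector `p ^ 2 * g` is the velocity at `t = 0` of the curve `(p + t g / 3) ^ 3`, which stays
in the cone. -/
theorem mul_mem_zariskiTangent_cube (p g : Forms n 2) (h : Forms n (2 * 3))
    (hh : (h : MvPolynomial (Fin n) ℂ) = (p : MvPolynomial (Fin n) ℂ) ^ 2 * g) :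
    h ∈ zariskiTangent (affineCone (powVariety n 2 3)) (powForm 3 p) := by
  intro f hf hV
  let e : Forms n 2 := (3⁻¹ : ℂ) • g
  obtain ⟨L, hL⟩ := exists_hasDerivAt_comp hf (powForm 3 p) h
  have h1 := hL (fun t => powForm 3 p + t • h) (by simp) fun φ => hasDerivAt_linear φ _ h
  have h2 := hL (fun t => powForm 3 (p + t • e)) (by simp) fun φ => by
    let u : Forms n (2 * 3) := ⟨C 3 * (p.1 * e.1 ^ 2), by
      have := (((isHomogeneous_C (Fin n) (3 : ℂ)).mul
        (((mem_homogeneousSubmodule _ _).1 p.2).mul (((mem_homogeneousSubmodule _ _).1 e.2).pow 2))))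
      simpa using this⟩
    have hexp (t : ℂ) : powForm 3 (p + t • e) =
        powForm 3 p + t • h + t ^ 2 • u + t ^ 3 • powForm 3 e := by
      refine Subtype.ext ?_
      simp only [powForm, Submodule.coe_add, Submodule.coe_smul, hh, u, e, smul_eq_C_mul]
      have hC : (C (3 : ℂ) : MvPolynomial (Fin n) ℂ) = 3 := map_ofNat _ 3
      have h3 : (C (3⁻¹ : ℂ) : MvPolynomial (Fin n) ℂ) * 3 = 1 := by
        rw [← hC, ← map_mul, inv_mul_cancel₀ (by norm_num), map_one]
      simp only [map_pow, hC]
      linear_combination C t * p.1 ^ 2 * g.1 * h3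
    have hd := (((hasDerivAt_linear φ (powForm 3 p) h).add
      (((hasDerivAt_id (0 : ℂ)).pow 2).mul_const (φ u))).add
      (((hasDerivAt_id (0 : ℂ)).pow 3).mul_const (φ (powForm 3 e))))
    have hφ : (fun t : ℂ => φ (powForm 3 (p + t • e))) = fun t => φ (powForm 3 p + t • h) +
        t ^ 2 * φ u + t ^ 3 * φ (powForm 3 e) := by
      funext t
      rw [hexp, map_add, map_add _ _ (t ^ 2 • u), map_smul, map_smul, smul_eq_mul, smul_eq_mul]
    rw [hφ]
    exact hd.congr_deriv (by simp)
  have h0 : (fun t : ℂ => f (powForm 3 (p + t • e))) = fun _ => 0 :=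
    funext fun t => hV _ (powForm_mem_affineCone (by norm_num) _)
  rw [h1.deriv, ← h2.deriv, h0, deriv_const]

/-- Cubing the identity `eval_jets_cube` gives, for each `x`, an equation satisfied by all cubes.
Its differential at `p ^ 3` expresses `h x` as `p x ^ 2` times a quadratic form in `x`. -/
theorem exists_eq_mul_of_mem_zariskiTangent_cube {p : Forms n 2} (hp : p ≠ 0)
    {h : Forms n (2 * 3)}
    (hh : h ∈ zariskiTangent (affineCone (powVariety n 2 3)) (powForm 3 p)) :
    ∃ G : MvPolynomial (Fin n) ℂ, G.IsHomogeneous 2 ∧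
      (h : MvPolynomial (Fin n) ℂ) = (p : MvPolynomial (Fin n) ℂ) ^ 2 * G := by
  obtain ⟨a, ha⟩ := exists_eval_ne_zero hp
  have hp2 : (p : MvPolynomial (Fin n) ℂ).IsHomogeneous 2 :=
    (mem_homogeneousSubmodule _ _).1 p.2
  let A : Module.Dual ℂ (Forms n (2 * 3)) := evalForm a
  let S (x : Fin n → ℂ) : Module.Dual ℂ (Forms n (2 * 3)) :=
    (aeval x : MvPolynomial (Fin n) ℂ →ₐ[ℂ] ℂ).toLinearMap ∘ₗ jetTwo a ∘ₗ Submodule.subtype _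
  let B (x : Fin n → ℂ) : Module.Dual ℂ (Forms n (2 * 3)) :=
    (aeval x : MvPolynomial (Fin n) ℂ →ₐ[ℂ] ℂ).toLinearMap ∘ₗ jetOne a ∘ₗ Submodule.subtype _
  have hA (F) : A F = eval a (F : MvPolynomial (Fin n) ℂ) := evalForm_apply a F
  have hS (x F) : S x F = eval x (jetTwo a (F : MvPolynomial (Fin n) ℂ)) := by
    simp [S, aeval_eq_eval]
  have hB (x F) : B x F = eval x (jetOne a (F : MvPolynomial (Fin n) ℂ)) := by
    simp [B, aeval_eq_eval]
  have key (x : Fin n → ℂ) : 5832 * eval a (p : MvPolynomial (Fin n) ℂ) ^ 15 * eval x h.1 =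
      eval x p.1 ^ 2 * (972 * eval a p.1 ^ 10 * (3 * (A h * eval x (jetTwo a (p.1 ^ 3)) +
        eval a p.1 ^ 3 * eval x (jetTwo a h.1)) -
        4 * eval x (jetOne a (p.1 ^ 3)) * eval x (jetOne a h.1)) -
        29160 * eval a p.1 ^ 12 * A h * eval x p.1) := by
    -- For `F = r ^ 3` the inner bracket is `18 * r(a) ^ 5 * r(x)`; its cube is `5832 * F(a) ^ 5 *
    -- F(x)`, since `18 ^ 3 = 5832`.
    let f : Forms n (2 * 3) → ℂ := fun F =>
      (3 * (A F * S x F) - 2 * B x F ^ 2) ^ 3 - 5832 * (A F ^ 5 * evalForm x F)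
    have hf : f ∈ polyFun (Forms n (2 * 3)) :=
      sub_mem (pow_mem (sub_mem
        (Subalgebra.smul_mem _ (mul_mem (dual_mem_polyFun A) (dual_mem_polyFun (S x))) (3 : ℂ))
        (Subalgebra.smul_mem _ (pow_mem (dual_mem_polyFun (B x)) 2) (2 : ℂ))) 3)
        (Subalgebra.smul_mem _ (mul_mem (pow_mem (dual_mem_polyFun A) 5)
          (dual_mem_polyFun (evalForm x))) (5832 : ℂ))
    have hV : ∀ y ∈ affineCone (powVariety n 2 3), f y = 0 := by
      intro y hy
      obtain ⟨r, rfl⟩ := exists_eq_powForm (by norm_num) hy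
      have hr := eval_jets_cube a x ((mem_homogeneousSubmodule _ _).1 r.2)
      have e : f (powForm 3 r) = (3 * eval a (r.1 ^ 3) * eval x (jetTwo a (r.1 ^ 3)) -
          2 * eval x (jetOne a (r.1 ^ 3)) ^ 2) ^ 3 -
          5832 * (eval a (r.1 ^ 3) ^ 5 * eval x (r.1 ^ 3)) := by
        simp [f, hA, hB, hS, evalForm_apply, powForm, mul_assoc]
      rw [e, hr, map_pow, map_pow]
      ring
    have hD := ((((((hasDerivAt_linear A (powForm 3 p) h).mul
      (hasDerivAt_linear (S x) (powForm 3 p) h)).const_mul 3).sub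
      (((hasDerivAt_linear (B x) (powForm 3 p) h).pow 2).const_mul 2)).pow 3).sub
      ((((hasDerivAt_linear A (powForm 3 p) h).pow 5).mul
      (hasDerivAt_linear (evalForm x) (powForm 3 p) h)).const_mul 5832)).deriv
    have hd := hD.symm.trans (hh f hf hV)
    have hj := eval_jets_cube a x hp2
    have hpow : ((powForm 3 p : Forms n (2 * 3)) : MvPolynomial (Fin n) ℂ) = p.1 ^ 3 := rfl
    simp only [zero_smul, add_zero, hA, hS, hB, evalForm_apply, Pi.mul_apply, Pi.sub_apply,
      Pi.pow_apply, hpow] at hd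
    rw [hA]
    rw [mul_assoc] at hj
    rw [hj] at hd
    simp only [map_pow] at hd
    push_cast at hd
    linear_combination -hd
  -- The cofactor of `p x ^ 2` in `key`, read as a polynomial in `x` and divided by the nonzero
  -- constant on the left.
  refine ⟨C (5832 * eval a p.1 ^ 15)⁻¹ * (C (972 * eval a p.1 ^ 10) *
    (C 3 * (C (A h) * jetTwo a (p.1 ^ 3) + C (eval a p.1 ^ 3) * jetTwo a h.1) -
      C 4 * (jetOne a (p.1 ^ 3) * jetOne a h.1)) - C (29160 * eval a p.1 ^ 12 * A h) * p.1),
    ?_, MvPolynomial.funext fun x => ?_⟩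
  · have hC (c : ℂ) {q : MvPolynomial (Fin n) ℂ} (hq : q.IsHomogeneous 2) :
        (C c * q).IsHomogeneous 2 := by
      simpa using (isHomogeneous_C (Fin n) c).mul hq
    exact hC _ ((hC _ ((hC _ ((hC _ (jetTwo_isHomogeneous a _)).add
      (hC _ (jetTwo_isHomogeneous a _)))).sub
      (hC _ ((jetOne_isHomogeneous a _).mul (jetOne_isHomogeneous a _))))).sub (hC _ hp2))
  · have h0 : (5832 * eval a p.1 ^ 15 : ℂ) ≠ 0 := mul_ne_zero (by norm_num) (pow_ne_zero _ ha)
    apply mul_left_cancel₀ h0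
    rw [key x]
    simp only [map_mul, map_sub, map_add, eval_C, map_pow]
    field_simp
end ContactLocus

namespace ContactLocus

open MvPolynomial

/-! ### Quadratic forms as bilinear forms -/

variable {n : ℕ}

theorem pderiv_pderiv_comm (i j : Fin n) (p : MvPolynomial (Fin n) ℂ) :
    pderiv i (pderiv j p) = pderiv j (pderiv i p) := by
  let D : Derivation ℂ (MvPolynomial (Fin n) ℂ) (MvPolynomial (Fin n) ℂ) := ⁅pderiv (R := ℂ) i, pderiv (R := ℂ) j⁆
  have h : D = 0 := derivation_ext fun k => by
    rw [Derivation.commutator_apply]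
    simp [pderiv_X, Pi.single_apply, apply_ite]
  have h' : D p = 0 := by rw [h, Derivation.zero_apply]
  rwa [Derivation.commutator_apply, sub_eq_zero] at h'

theorem exists_bilinForm {p : MvPolynomial (Fin n) ℂ} (hp : p.IsHomogeneous 2) :
    ∃ B : LinearMap.BilinForm ℂ (Fin n → ℂ), B.IsSymm ∧ ∀ x, eval x p = B x x := by
  -- Half the Hessian; it is constant, so evaluating it at 0 loses nothing.
  let M : Matrix (Fin n) (Fin n) ℂ := fun i j => 2⁻¹ * eval 0 (pderiv j (pderiv i p))
  refine ⟨Matrix.toBilin' M, ?_, fun x => ?_⟩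
  · rw [Matrix.isSymm_toBilin'_iff_isSymm]
    ext i j
    change 2⁻¹ * eval 0 (pderiv i (pderiv j p)) = 2⁻¹ * eval 0 (pderiv j (pderiv i p))
    rw [pderiv_pderiv_comm]
  · have h := eval_jetTwo_of_isHomogeneous 0 x hp
    rw [eval_jetTwo] at h
    rw [Matrix.toBilin'_apply]
    apply mul_left_cancel₀ (two_ne_zero (α := ℂ))
    rw [← h, Finset.mul_sum]
    refine Finset.sum_congr rfl fun i _ => ?_
    rw [Finset.mul_sum]
    refine Finset.sum_congr rfl fun j _ => ?_
    simp only [M]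
    ring

/-! ### Binomial weights and test planes -/

/-- Coefficient vectors of the linear forms whose squares make up the binomial set, the first one
being rescaled so that all of them take the value `2` at `(1, …, 1)`. -/
def IsBinomialWeight [NeZero n] (w : Fin n → ℂ) : Prop :=
  ∑ i, w i = 2 ∧ ∀ k, k ≠ 0 → w k = 0 ∨ w k = 1

/-- The linear form with coefficients `w`. -/
noncomputable def linForm (w : Fin n → ℂ) : MvPolynomial (Fin n) ℂ := ∑ i, C (w i) * X i

/-- The first vector spanning a test plane. -/
def testDir (j k : Fin n) : Fin n → ℂ :=
  if j = k then Pi.single j 1 else Pi.single j 1 - Pi.single k 1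

/-- The second vector spanning a test plane. -/
def testBase (j k : Fin n) : Fin n → ℂ :=
  if j = k then 1 - (2 : ℂ) • Pi.single j 1
  else 1 - (2 : ℂ) • Pi.single j 1 - (2 : ℂ) • Pi.single k 1

theorem linForm_isHomogeneous (w : Fin n → ℂ) : (linForm w).IsHomogeneous 1 :=
  IsHomogeneous.sum _ _ _ fun i _ => by
    simpa using (isHomogeneous_C (Fin n) (w i)).mul (isHomogeneous_X ℂ i)

theorem eval_linForm (w x : Fin n → ℂ) : eval x (linForm w) = w ⬝ᵥ x := by
  simp [linForm, dotProduct]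

variable [NeZero n]

/-- As the entries of `w` sum to 2, the two pairings are `w j - w k` and `2 - 2 * w j - 2 * w k`
(for `j = k`: `w j` and `2 - 2 * w j`). With entries 0 or 1, exactly one of the two is zero. -/
theorem IsBinomialWeight.test {w : Fin n → ℂ} (hw : IsBinomialWeight w) {j k : Fin n}
    (hj : j ≠ 0) (hk : k ≠ 0) :
    (w j = w k ∧ j ≠ k ∨ j = k ∧ w j = 0) ∧ w ⬝ᵥ testDir j k = 0 ∧ w ⬝ᵥ testBase j k ≠ 0 ∨
    (w j ≠ w k ∨ j = k ∧ w j = 1) ∧ w ⬝ᵥ testDir j k ≠ 0 ∧ w ⬝ᵥ testBase j k = 0 := by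
  have h1 : w ⬝ᵥ (1 : Fin n → ℂ) = 2 := by rw [dotProduct_one]; exact hw.1
  by_cases hjk : j = k
  · subst hjk
    rcases hw.2 j hj with h | h <;>
    simp [testDir, testBase, dotProduct_sub, h1, h]
  · rcases hw.2 j hj with h | h <;> rcases hw.2 k hk with h' | h' <;>
    simp [testDir, testBase, dotProduct_sub, h1, h, h', hjk]

/-- A quadratic form which satisfies the test conditions of a binomial weight `w` is a multiple of
the square of the linear form with coefficients `w`. -/
theorem exists_eq_smul_sq {B : LinearMap.BilinForm ℂ (Fin n → ℂ)} (hB : B.IsSymm)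
    {w : Fin n → ℂ} (hw : IsBinomialWeight w)
    (h0 : ∀ j k, j ≠ 0 → k ≠ 0 → B (testDir j k) (testBase j k) = 0)
    (h1 : ∀ j k, j ≠ 0 → k ≠ 0 → w ⬝ᵥ testDir j k = 0 → B (testDir j k) (testDir j k) = 0)
    (h2 : ∀ j k, j ≠ 0 → k ≠ 0 → w ⬝ᵥ testBase j k = 0 → B (testBase j k) (testBase j k) = 0) :
    ∃ c : ℂ, ∀ x, B x x = c * (w ⬝ᵥ x) ^ 2 := by
  let e (i : Fin n) : Fin n → ℂ := Pi.single i 1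
  have hone : (1 : Fin n → ℂ) = ∑ i, e i := by
    funext i
    simp [e, Finset.sum_apply, Pi.single_apply]
  have symm (x y) : B x y = B y x := hB.eq x y
  -- Forced by `(w ⬝ᵥ 1) ^ 2 = 4`.
  let c : ℂ := B 1 1 / 4
  have hc : B 1 1 = 4 * c := by simp only [c]; ring
  have row (k) (hk : k ≠ 0) : B (e k) 1 = 2 * B (e k) (e k) := by
    have h := h0 k k hk hk
    simp only [testDir, testBase, if_true, map_sub, map_smul, smul_eq_mul] at h
    linear_combination h
  -- Either `e k` or `1 - 2 • e k` is isotropic, according to `w k`; in the second case `row`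
  -- reduces isotropy to `4 * c - 4 * B (e k) (e k) = 0`.
  have diag (k) (hk : k ≠ 0) : B (e k) (e k) = c * w k := by
    have ha := h1 k k hk hk
    have hb := h2 k k hk hk
    have hr := row k hk
    have hs := symm 1 (e k)
    rcases hw.test hk hk with ⟨h, h', -⟩ | ⟨h, -, h'⟩
    · have hwk : w k = 0 := by simpa using h
      have ha' := ha h'
      simp only [testDir, if_true] at ha'
      rw [hwk, mul_zero]
      exact ha'
    · have hwk : w k = 1 := by simpa using h
      have hb' := hb h'
      simp only [testBase, if_true, map_sub, map_smul, smul_eq_mul, LinearMap.sub_apply,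
        LinearMap.smul_apply] at hb'
      change B 1 1 - 2 * B (e k) 1 - 2 * (B 1 (e k) - 2 * B (e k) (e k)) = 0 at hb'
      rw [hwk]
      linear_combination (hc - hb' - 4 * hr - 2 * hs) / 4
  -- For `j ≠ k`, the isotropic vector is `e j - e k` if `w j = w k`, and `1 - 2 • e j - 2 • e k`
  -- otherwise; expanding it isolates the mixed entry.
  have entry (j k) (hj : j ≠ 0) (hk : k ≠ 0) : B (e j) (e k) = c * w j * w k := by
    by_cases hjk : j = k
    · subst hjk
      rw [diag j hj]
      rcases hw.2 j hj with h | h <;> simp [h]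
    have ha := h1 j k hj hk
    have hb := h2 j k hj hk
    have hsj := symm 1 (e j)
    have hsk := symm 1 (e k)
    have hs := symm (e k) (e j)
    have hrj := row j hj
    have hrk := row k hk
    have hdj := diag j hj
    have hdk := diag k hk
    rcases hw.test hj hk with ⟨h, h', -⟩ | ⟨h, -, h'⟩
    · have hwk : w j = w k := by simpa [hjk] using h
      have ha' := ha h'
      simp only [testDir, hjk, if_false, map_sub, LinearMap.sub_apply] at ha'
      change B (e j) (e j) - B (e k) (e j) - (B (e j) (e k) - B (e k) (e k)) = 0 at ha'
      rcases hw.2 j hj with hwj | hwj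
      · rw [← hwk, hwj] at hdk ⊢
        rw [hwj] at hdj
        linear_combination (hdk + hdj - hs - ha') / 2
      · rw [← hwk, hwj] at hdk ⊢
        rw [hwj] at hdj
        linear_combination (hdk + hdj - hs - ha') / 2
    · have hwk : w j ≠ w k := by simpa [hjk] using h
      have hb' := hb h'
      simp only [testBase, hjk, if_false, map_sub, map_smul, smul_eq_mul, LinearMap.sub_apply,
        LinearMap.smul_apply] at hb'
      change B 1 1 - 2 * B (e j) 1 - 2 * B (e k) 1 - 2 * (B 1 (e j) - 2 * B (e j) (e j) -
        2 * B (e k) (e j)) - 2 * (B 1 (e k) - 2 * B (e j) (e k) - 2 * B (e k) (e k)) = 0 at hb'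
      have hsum : w j + w k = 1 ∧ w j * w k = 0 := by
        rcases hw.2 j hj with h | h <;> rcases hw.2 k hk with h' | h' <;> simp_all
      linear_combination (hb' - hc + 4 * hrj + 4 * hrk + 2 * hsj + 2 * hsk + 4 * hdj + 4 * hdk -
        4 * hs + 4 * c * hsum.1) / 8 - c * hsum.2
  have split (f : Fin n → ℂ) : ∑ i, f i = f 0 + ∑ i ∈ Finset.univ.erase 0, f i :=
    (Finset.add_sum_erase _ _ (Finset.mem_univ 0)).symm
  have hw0 : w 0 + ∑ i ∈ Finset.univ.erase 0, w i = 2 := by rw [← split, hw.1]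
  -- No test involves the index 0 alone; its entries come from the row sums and, for the corner,
  -- from `B 1 1 = 4 * c`.
  have col (k) (hk : k ≠ 0) : B (e k) (e 0) = c * w k * w 0 := by
    have hr := row k hk
    rw [hone, map_sum, split, diag k hk] at hr
    rw [Finset.sum_congr rfl fun j hj => entry k j hk (Finset.ne_of_mem_erase hj),
      ← Finset.mul_sum] at hr
    linear_combination hr - c * w k * hw0
  have corner : B (e 0) (e 0) = c * w 0 * w 0 := by
    have h10 : B 1 (e 0) = B (e 0) (e 0) + c * w 0 * ∑ i ∈ Finset.univ.erase 0, w i := by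
      rw [hone, map_sum, LinearMap.sum_apply, split,
        Finset.sum_congr rfl fun j hj => col j (Finset.ne_of_mem_erase hj), Finset.mul_sum]
      congr 1
      exact Finset.sum_congr rfl fun j _ => by ring
    have h11 : B 1 1 = B 1 (e 0) + 2 * c * ∑ i ∈ Finset.univ.erase 0, w i := by
      have h (j) (hj : j ∈ Finset.univ.erase 0) : B 1 (e j) = 2 * c * w j := by
        rw [symm, row j (Finset.ne_of_mem_erase hj), diag j (Finset.ne_of_mem_erase hj)]
        ring
      conv_lhs => rw [show B 1 1 = B 1 (∑ i, e i) by rw [← hone]]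
      rw [map_sum, split, Finset.sum_congr rfl h, Finset.mul_sum]
    linear_combination hc - h11 - h10 - (2 * c + c * w 0) * hw0
  have all (j k) : B (e j) (e k) = c * w j * w k := by
    by_cases hj : j = 0
    · subst hj
      by_cases hk : k = 0
      · subst hk
        exact corner
      · rw [symm, col k hk]
        ring
    · by_cases hk : k = 0
      · subst hk
        exact col j hj
      · exact entry j k hj hk
  refine ⟨c, fun x => ?_⟩
  have hx : x = ∑ i, x i • e i := by
    funext i
    simp [e, Finset.sum_apply, Pi.single_apply]
  conv_lhs => rw [hx]
  rw [sq, dotProduct, Finset.sum_mul_sum, Finset.mul_sum]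
  simp only [map_sum, LinearMap.sum_apply, map_smul, LinearMap.smul_apply, smul_eq_mul, all]
  refine Finset.sum_congr rfl fun i _ => ?_
  simp only [Finset.mul_sum]
  exact Finset.sum_congr rfl fun j _ => by ring

end ContactLocus

namespace ContactLocus

open MvPolynomial

variable {n : ℕ}

/-! ### Restriction to a plane -/

/-- Restriction of polynomials to the affine line through `a` with direction `b`. For a form, this
is its dehomogenized restriction to the plane spanned by `a` and `b`. -/
noncomputable def restrict (a b : Fin n → ℂ) : MvPolynomial (Fin n) ℂ →ₐ[ℂ] Polynomial ℂ :=
  aeval fun i => Polynomial.C (a i) + Polynomial.C (b i) * Polynomial.X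

theorem eval_restrict (a b : Fin n → ℂ) (p : MvPolynomial (Fin n) ℂ) (t : ℂ) :
    (restrict a b p).eval t = eval (a + t • b) p := by
  have h : ((Polynomial.aeval t).comp (restrict a b) : MvPolynomial (Fin n) ℂ →ₐ[ℂ] ℂ) =
      aeval (a + t • b) :=
    algHom_ext fun i => by
      simp [restrict]
      ring
  simpa [aeval_eq_eval] using DFunLike.congr_fun h p

theorem restrict_linForm (a b w : Fin n → ℂ) :
    restrict a b (linForm w) = Polynomial.C (w ⬝ᵥ a) + Polynomial.C (w ⬝ᵥ b) * Polynomial.X :=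
  Polynomial.funext fun t => by
    simp [eval_restrict, eval_linForm]
    ring

theorem restrict_eq_of_bilinForm {B : LinearMap.BilinForm ℂ (Fin n → ℂ)} (hB : B.IsSymm)
    {p : MvPolynomial (Fin n) ℂ} (hp : ∀ x, eval x p = B x x) (a b : Fin n → ℂ) :
    restrict a b p = Polynomial.C (B a a) + Polynomial.C (2 * B a b) * Polynomial.X +
      Polynomial.C (B b b) * Polynomial.X ^ 2 :=
  Polynomial.funext fun t => by
    have h : B b a = B a b := hB.eq b a
    simp [eval_restrict, hp, h]
    ring

/-- The coefficient of `s ^ 3 * t ^ 3` of the restriction of a form to a plane. -/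
noncomputable def midCoeff (a b : Fin n → ℂ) : Module.Dual ℂ (Forms n (2 * 3)) :=
  Polynomial.lcoeff ℂ 3 ∘ₗ (restrict a b).toLinearMap ∘ₗ Submodule.subtype _

theorem midCoeff_apply (a b : Fin n → ℂ) (F : Forms n (2 * 3)) :
    midCoeff a b F = (restrict a b F.1).coeff 3 := rfl


/-- On the line `a + X b`, the fourth power of the linear form is a multiple of `X ^ 4` or a
constant. Multiplied by a polynomial of degree at most 2, neither yields an `X ^ 3` term. -/
theorem midCoeff_eq_zero {a b w : Fin n → ℂ} (h : w ⬝ᵥ a = 0 ∨ w ⬝ᵥ b = 0)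
    {G : MvPolynomial (Fin n) ℂ} (hG : G.IsHomogeneous 2) {F : Forms n (2 * 3)} {c : ℂ}
    (hF : F.1 = (C c * linForm w ^ 2) ^ 2 * G) : midCoeff a b F = 0 := by
  obtain ⟨B, hB, hGB⟩ := exists_bilinForm hG
  rw [midCoeff_apply, hF, map_mul, map_pow, map_mul, map_pow, restrict_linForm,
    restrict_eq_of_bilinForm hB hGB]
  have hc : restrict a b (C c) = Polynomial.C c := by simp [restrict]
  rw [hc]
  rcases h with h | h
  · have e : (Polynomial.C c * (Polynomial.C (w ⬝ᵥ a) +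
        Polynomial.C (w ⬝ᵥ b) * Polynomial.X) ^ 2) ^ 2 *
        (Polynomial.C (B a a) + Polynomial.C (2 * B a b) * Polynomial.X +
          Polynomial.C (B b b) * Polynomial.X ^ 2) =
        (Polynomial.C (c ^ 2 * (w ⬝ᵥ b) ^ 4) * (Polynomial.C (B a a) +
          Polynomial.C (2 * B a b) * Polynomial.X + Polynomial.C (B b b) * Polynomial.X ^ 2)) *
          Polynomial.X ^ 4 := by
      rw [h]
      simp only [map_mul, map_pow, map_zero]
      ring
    rw [e, Polynomial.coeff_mul_X_pow']
    norm_num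
  · rw [h]
    have e : (Polynomial.C c * (Polynomial.C (w ⬝ᵥ a) +
        Polynomial.C 0 * Polynomial.X) ^ 2) ^ 2 = Polynomial.C (c ^ 2 * (w ⬝ᵥ a) ^ 4) := by
      simp only [map_mul, map_pow, map_zero]
      ring
    rw [e, Polynomial.coeff_C_mul]
    simp [Polynomial.coeff_X_pow]

theorem coeff_quadratic_sq (u v w : ℂ) :
    ((Polynomial.C u + Polynomial.C v * Polynomial.X + Polynomial.C w * Polynomial.X ^ 2) ^ 2) =
      Polynomial.C (u ^ 2) + Polynomial.C (2 * u * v) * Polynomial.X +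
        Polynomial.C (v ^ 2 + 2 * u * w) * Polynomial.X ^ 2 +
        Polynomial.C (2 * v * w) * Polynomial.X ^ 3 + Polynomial.C (w ^ 2) * Polynomial.X ^ 4 := by
  simp only [map_mul, map_pow, map_add, map_ofNat]
  ring

/-- If the multiples of `p ^ 2` have no middle coefficient on the plane spanned by `a` and `b`,
then the restriction of `p` to this plane is a multiple of a square of a coordinate. -/
theorem bilinForm_eq_zero_of_midCoeff {B : LinearMap.BilinForm ℂ (Fin n → ℂ)} (hB : B.IsSymm)
    {p : Forms n 2} (hp : ∀ x, eval x p.1 = B x x) {a b s t : Fin n → ℂ}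
    (hsa : s ⬝ᵥ a = 1) (hsb : s ⬝ᵥ b = 0) (hta : t ⬝ᵥ a = 0) (htb : t ⬝ᵥ b = 1)
    (h : ∀ g : Forms n 2, ∀ F : Forms n (2 * 3), F.1 = p.1 ^ 2 * g.1 → midCoeff a b F = 0) :
    B a b = 0 ∧ B a a * B b b = 0 := by
  have key (g : MvPolynomial (Fin n) ℂ) (hg : g.IsHomogeneous 2) :
      (restrict a b (p.1 ^ 2 * g)).coeff 3 = 0 :=
    h ⟨g, (mem_homogeneousSubmodule _ _).2 hg⟩ ⟨p.1 ^ 2 * g, (mem_homogeneousSubmodule _ _).2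
      ((((mem_homogeneousSubmodule _ _).1 p.2).pow 2).mul hg)⟩ rfl
  have hs : restrict a b (linForm s) = 1 := by simp [restrict_linForm, hsa, hsb]
  have ht : restrict a b (linForm t) = Polynomial.X := by simp [restrict_linForm, hta, htb]
  have k1 := key _ ((linForm_isHomogeneous s).mul (linForm_isHomogeneous s))
  have k2 := key _ ((linForm_isHomogeneous s).mul (linForm_isHomogeneous t))
  have k3 := key _ ((linForm_isHomogeneous t).mul (linForm_isHomogeneous t))
  rw [map_mul, map_mul (restrict a b) (linForm _), hs, map_pow, restrict_eq_of_bilinForm hB hp,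
    coeff_quadratic_sq, one_mul, mul_one] at k1
  rw [map_mul, map_mul (restrict a b) (linForm _), hs, ht, map_pow,
    restrict_eq_of_bilinForm hB hp, coeff_quadratic_sq, one_mul, Polynomial.coeff_mul_X] at k2
  rw [map_mul, map_mul (restrict a b) (linForm _), ht, map_pow, restrict_eq_of_bilinForm hB hp,
    coeff_quadratic_sq, ← mul_assoc, Polynomial.coeff_mul_X, Polynomial.coeff_mul_X] at k3
  simp only [Polynomial.coeff_add, Polynomial.coeff_C_mul, Polynomial.coeff_C,
    Polynomial.coeff_X, Polynomial.coeff_X_pow] at k1 k2 k3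
  norm_num at k1 k2 k3
  -- With restriction `u + v X + w X ^ 2`, the three choices of `g` give `v w = 0`, `v ^ 2 + 2 u w =
  -- 0` and `u v = 0`, so `v ^ 3 = 0`; here `v = 2 * B a b`.
  have hab : B a b = 0 := by grind
  refine ⟨hab, ?_⟩
  rw [hab] at k2
  linear_combination k2 / 2
end ContactLocus

namespace ContactLocus

/-! ### Isolated points of the tangential contact locus -/

section Topological

variable {E : Type*} [AddCommGroup E] [Module ℂ E]

theorem isOpen_affineZariski {f : E → ℂ} (hf : f ∈ polyFun E) :
    IsOpen[affineZariski E] {x | f x ≠ 0} :=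
  TopologicalSpace.isOpen_generateFrom_of_mem ⟨f, hf, rfl⟩

theorem isOpen_projectiveZariski (φ : Module.Dual ℂ E) : IsOpen {z : ℙ ℂ E | φ z.rep ≠ 0} :=
  TopologicalSpace.isOpen_generateFrom_of_mem
    ⟨φ, dual_mem_polyFun φ, 1, fun c x => by simp, rfl⟩

/-- Distinct lines are separated by a linear functional that kills one of them and not the other. -/
instance projectiveZariski_t1Space : T1Space (ℙ ℂ E) where
  t1 x := by
    rw [← isOpen_compl_iff, isOpen_iff_forall_mem_open]
    intro z hz
    have hzx : z.rep ∉ Submodule.span ℂ {x.rep} := by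
      intro h
      obtain ⟨c, hc⟩ := Submodule.mem_span_singleton.1 h
      apply hz
      rw [Set.mem_singleton_iff, ← z.mk_rep, ← x.mk_rep, Projectivization.mk_eq_mk_iff']
      exact ⟨c, hc⟩
    obtain ⟨φ, hφ, hx⟩ := Submodule.exists_le_ker_of_notMem hzx
    refine ⟨{y | φ y.rep ≠ 0}, fun y hy hyx => hy ?_, isOpen_projectiveZariski φ, hφ⟩
    rw [Set.mem_singleton_iff] at hyx
    rw [hyx]
    exact hx (Submodule.mem_span_singleton_self _)

variable {I : Type*} {W : Set (ℙ ℂ E)} {x : I → ℙ ℂ E}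

theorem mem_tangentialGamma_self (hx : ∀ i, x i ∈ W) (i : I) : x i ∈ tangentialGamma W x :=
  ⟨hx i, le_iSup (fun i => embeddedTangent W (x i)) i⟩

theorem contactLocus_subset_tangentialGamma : contactLocus W x ⊆ tangentialGamma W x := by
  rintro z ⟨K, -, ⟨y, -, rfl⟩, -⟩
  exact y.2

theorem mem_contactLocus_self (hx : ∀ i, x i ∈ W) (i : I) : x i ∈ contactLocus W x := by
  let y : tangentialGamma W x := ⟨x i, mem_tangentialGamma_self hx i⟩
  have hy : x i ∈ Subtype.val '' irreducibleComponent y := ⟨y, mem_irreducibleComponent, rfl⟩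
  exact ⟨_, irreducibleComponent_mem_irreducibleComponents y, hy, i, hy⟩

/-- If the points `x i` are isolated in `Γ_W(x)`, then they exhaust the contact locus. -/
theorem contactLocus_subset_range
    (hiso : ∀ i, ∃ U, IsOpen U ∧ x i ∈ U ∧ U ∩ tangentialGamma W x ⊆ {x i}) :
    contactLocus W x ⊆ Set.range x := by
  rintro z ⟨K, hK, ⟨y, hy, rfl⟩, i, u, hu, hui⟩
  obtain ⟨U, hU, hxU, hsub⟩ := hiso i
  have hV : IsOpen (Subtype.val ⁻¹' U : Set (tangentialGamma W x)) :=
    hU.preimage continuous_subtype_val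
  have hKU : K ∩ Subtype.val ⁻¹' U ⊆ {u} := by
    rintro v ⟨-, hv⟩
    exact Subtype.ext ((hsub ⟨hv, v.2⟩ : v.1 = x i).trans hui.symm)
  have huU : u ∈ (Subtype.val ⁻¹' U : Set (tangentialGamma W x)) := by
    rw [Set.mem_preimage, hui]
    exact hxU
  -- An irreducible set is the closure of its nonempty open part, here one point, which is closed.
  have hcl := subset_closure_inter_of_isPreirreducible_of_isOpen hK.prop.isPreirreducible hV
    ⟨u, hu, huU⟩
  have hyu : y = u := by simpa using closure_mono hKU (hcl hy)
  exact ⟨i, by rw [hyu, hui]⟩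

end Topological

/-- Since `z` lies in every `U ∩ S`, no competing dimension is `⊥`; the isolating neighbourhood
attains 0. -/
theorem localDim_eq_zero {T : Type*} [TopologicalSpace T] {S U : Set T} {z : T} (hz : z ∈ S)
    (hU : IsOpen U) (hzU : z ∈ U) (hsub : U ∩ S ⊆ {z}) : localDim S z = 0 := by
  have hne (U : {U : Set T // IsOpen U ∧ z ∈ U}) : 0 ≤ topologicalKrullDim ↥(U.1 ∩ S) := by
    let u : ↥(U.1 ∩ S) := ⟨z, U.2.2, hz⟩
    have : Nonempty (TopologicalSpace.IrreducibleCloseds ↥(U.1 ∩ S)) :=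
      ⟨⟨closure {u}, isIrreducible_singleton.closure, isClosed_closure⟩⟩
    exact Order.krullDim_nonneg
  refine le_antisymm ?_ (le_iInf hne)
  refine (iInf_le _ ⟨U, hU, hzU⟩).trans ?_
  have : Subsingleton ↥(U ∩ S) :=
    ⟨fun v w => Subtype.ext ((hsub v.2 : v.1 = z).trans (hsub w.2 : w.1 = z).symm)⟩
  have : DiscreteTopology ↥(U ∩ S) := Subsingleton.discreteTopology
  exact topologicalKrullDim_zero_of_discreteTopology _

open MvPolynomial

variable {n : ℕ}

/-! ### Open neighbourhoods defined by test vectors -/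

/-- The vectors spanning the test planes. -/
def testVec (i : Fin n × Fin n × Bool) : Fin n → ℂ :=
  if i.2.2 then testDir i.1 i.2.1 else testBase i.1 i.2.1

/-- The polynomials which do not vanish at those test vectors where the linear form with
coefficients `w` does not vanish. -/
def NonvanishingLike (w : Fin n → ℂ) (F : MvPolynomial (Fin n) ℂ) : Prop :=
  ∀ i : {i // w ⬝ᵥ testVec i ≠ 0}, eval (testVec i.1) F ≠ 0

theorem isOpen_nonvanishingLike (w : Fin n → ℂ) :
    IsOpen[affineZariski (Forms n 2)] {p | NonvanishingLike w p.1} := by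
  simp only [NonvanishingLike, Set.ofPred_forall, ← evalForm_apply]
  exact @isOpen_iInter_of_finite _ _ (affineZariski (Forms n 2)) _ _ fun i =>
    isOpen_affineZariski (dual_mem_polyFun (evalForm (testVec i.1)))

theorem isOpen_nonvanishingLike_rep (w : Fin n → ℂ) :
    IsOpen {z : ℙ ℂ (Forms n (2 * 3)) | NonvanishingLike w z.rep.1} := by
  simp only [NonvanishingLike, Set.ofPred_forall, ← evalForm_apply]
  exact isOpen_iInter_of_finite fun i => isOpen_projectiveZariski (evalForm (testVec i.1))

theorem nonvanishingLike_self {w : Fin n → ℂ} {c : ℂ} (hc : c ≠ 0) {q : Forms n 2}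
    (hq : q.1 = C c * linForm w ^ 2) : NonvanishingLike w q.1 := fun i => by
  rw [hq, map_mul, eval_C, map_pow, eval_linForm]
  exact mul_ne_zero hc (pow_ne_zero 2 i.2)

theorem nonvanishingLike_rep_iff {w : Fin n → ℂ} {p : Forms n 2} (hp : p ≠ 0) :
    NonvanishingLike w (powMap n 2 3 (Projectivization.mk ℂ p hp)).rep.1 ↔
      NonvanishingLike w p.1 := by
  obtain ⟨e, he, hrep⟩ := rep_powMap_mk (d := 3) (by norm_num) hp
  rw [hrep]
  refine forall_congr' fun i => ?_
  simp [powForm, smul_eval, he]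

variable [NeZero n]

/-! ### The binomial set -/

/-- Indexing by the pairs and the singleton `{0}` puts both kinds of elements into one shape, ready
for counting. -/
theorem mem_binomialSet_iff {q : Forms n 2} : q ∈ binomialSet n ↔
    ∃ s ∈ insert {0} (Finset.powersetCard 2 (Finset.univ : Finset (Fin n))),
      q.1 = (∑ i ∈ s, X i) ^ 2 := by
  simp only [Finset.mem_insert, Finset.mem_powersetCard, Finset.card_eq_two, exists_eq_or_imp,
    Finset.sum_singleton, Finset.subset_univ, true_and, binomialSet, Set.mem_ofPred_eq]
  rw [or_comm]
  refine or_congr Iff.rfl ⟨?_, ?_⟩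
  · rintro ⟨i, j, hij, h⟩
    exact ⟨{i, j}, ⟨i, j, hij.ne, rfl⟩, by rw [Finset.sum_pair hij.ne, h]⟩
  · rintro ⟨s, ⟨i, j, hij, rfl⟩, h⟩
    rw [Finset.sum_pair hij] at h
    rcases lt_or_gt_of_ne hij with h' | h'
    · exact ⟨i, j, h', h⟩
    · exact ⟨j, i, h', by rw [h, add_comm]⟩

theorem ncard_binomialSet : (binomialSet n).ncard = n.choose 2 + 1 := by
  let f (s : Finset (Fin n)) : Forms n 2 := ⟨(∑ i ∈ s, X i) ^ 2,
    (mem_homogeneousSubmodule _ _).2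
      ((IsHomogeneous.sum s _ 1 fun i _ => isHomogeneous_X ℂ i).pow 2)⟩
  have hf : Function.Injective f := by
    intro s t hst
    ext k
    -- At the `k`-th basis vector the square takes the value 1 or 0 according to whether `k ∈ s`.
    have h : eval (Pi.single k (1 : ℂ)) ((∑ i ∈ s, X i) ^ 2) =
      eval (Pi.single k (1 : ℂ)) ((∑ i ∈ t, X i) ^ 2) := congrArg (eval _) (congrArg Subtype.val hst)
    simp only [map_pow, map_sum, eval_X, Pi.single_apply, Finset.sum_ite_eq'] at h
    by_cases hs : k ∈ s <;> by_cases ht : k ∈ t <;> simp_all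
  have himg : binomialSet n =
      f '' (insert {0} (Finset.powersetCard 2 (Finset.univ : Finset (Fin n))) : Finset _) := by
    ext q
    rw [mem_binomialSet_iff]
    exact exists_congr fun s => and_congr Iff.rfl
      ⟨fun h => Subtype.ext h.symm, fun h => (congrArg Subtype.val h).symm⟩
  rw [himg, Set.ncard_image_of_injective _ hf, Set.ncard_coe_finset, Finset.card_insert_of_notMem,
    Finset.card_powersetCard, Finset.card_univ, Fintype.card_fin]
  simp

theorem exists_weight_of_mem_binomialSet {q : Forms n 2} (hq : q ∈ binomialSet n) :
    ∃ (w : Fin n → ℂ) (c : ℂ), IsBinomialWeight w ∧ c ≠ 0 ∧ q.1 = C c * linForm w ^ 2 := by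
  obtain ⟨s, hs, h⟩ := mem_binomialSet_iff.1 hq
  rcases Finset.mem_insert.1 hs with rfl | hs
  -- The square of the first variable is written as `(2 X_0) ^ 2 / 4` to meet the normalisation.
  · refine ⟨Pi.single 0 2, 4⁻¹, ⟨by simp, fun k hk => Or.inl (by simp [hk])⟩, by norm_num, ?_⟩
    rw [h]
    refine MvPolynomial.funext fun x => ?_
    simp [eval_linForm]
    ring
  · have hc := (Finset.mem_powersetCard.1 hs).2
    refine ⟨fun i => if i ∈ s then 1 else 0, 1, ⟨by simp [hc], fun k _ => ?_⟩, one_ne_zero, ?_⟩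
    · by_cases hk : k ∈ s <;> simp [hk]
    · rw [h]
      refine MvPolynomial.funext fun x => ?_
      simp [eval_linForm, dotProduct]

/-! ### The contact locus of the cubes of the binomial set -/

/-- The points of `ℙ(S^6)` given by the cubes of the binomial set. -/
noncomputable def binomialCube (q : binomialSet n) : ℙ ℂ (Forms n (2 * 3)) :=
  powMap n 2 3 (Projectivization.mk ℂ (q : Forms n 2) (binomialSet_ne_zero q))

theorem midCoeff_eq_zero_of_mem_iSup {j k : Fin n} (hj : j ≠ 0) (hk : k ≠ 0)
    {F : Forms n (2 * 3)}
    (hF : F ∈ ⨆ q : binomialSet n, embeddedTangent (powVariety n 2 3) (binomialCube q)) :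
    midCoeff (testDir j k) (testBase j k) F = 0 := by
  have hle : ⨆ q : binomialSet n, embeddedTangent (powVariety n 2 3) (binomialCube q) ≤
      LinearMap.ker (midCoeff (testDir j k) (testBase j k)) := by
    refine iSup_le fun q h hh => ?_
    obtain ⟨w, c, hw, hc, hq⟩ := exists_weight_of_mem_binomialSet q.2
    obtain ⟨e, he, hrep⟩ := rep_powMap_mk (d := 3) (by norm_num) (binomialSet_ne_zero q)
    rw [embeddedTangent, binomialCube, hrep] at hh
    obtain ⟨G, hG, hG'⟩ :=
      exists_eq_mul_of_mem_zariskiTangent_cube (smul_ne_zero he (binomialSet_ne_zero q)) hh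
    refine midCoeff_eq_zero (w := w) (c := e * c) ?_ hG ?_
    · rcases hw.test hj hk with h | h
      · exact Or.inl h.2.1
      · exact Or.inr h.2.2
    · rw [hG', Submodule.coe_smul, hq, smul_eq_C_mul, C_mul, mul_assoc (C e)]
  exact hle hF

theorem bilinForm_test_of_mem_tangentialGamma {p : Forms n 2} (hp : p ≠ 0)
    (h : powMap n 2 3 (Projectivization.mk ℂ p hp) ∈
      tangentialGamma (powVariety n 2 3) (binomialCube (n := n)))
    {B : LinearMap.BilinForm ℂ (Fin n → ℂ)} (hB : B.IsSymm) (hpB : ∀ x, eval x p.1 = B x x)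
    {j k : Fin n} (hj : j ≠ 0) (hk : k ≠ 0) :
    B (testDir j k) (testBase j k) = 0 ∧
      B (testDir j k) (testDir j k) * B (testBase j k) (testBase j k) = 0 := by
  obtain ⟨e, he, hrep⟩ := rep_powMap_mk (d := 3) (by norm_num) hp
  -- These are coordinates dual to the test vectors: `testBase` is 1 at index 0 and -1 at `j`, while
  -- `testDir` is 0 and 1 there.
  refine bilinForm_eq_zero_of_midCoeff hB hpB (s := Pi.single 0 1 + Pi.single j 1)
    (t := Pi.single 0 1) ?_ ?_ ?_ ?_ fun g F hF => ?_
  · by_cases hjk : j = k <;> simp [testDir, hjk, hk, hj]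
  · by_cases hjk : j = k <;>
      simp [testBase, hjk, hk, hj, add_dotProduct] <;> norm_num
  · by_cases hjk : j = k <;> simp [testDir, hjk, hk, hj]
  · by_cases hjk : j = k <;> simp [testBase, hjk, hk, hj]
  · refine midCoeff_eq_zero_of_mem_iSup hj hk (h.2 ?_)
    rw [embeddedTangent, hrep]
    refine mul_mem_zariskiTangent_cube _ ((e ^ 2)⁻¹ • g) _ ?_
    have hC : (C e : MvPolynomial (Fin n) ℂ) ^ 2 * C (e ^ 2)⁻¹ = 1 := by
      rw [← C_pow, ← C_mul, mul_inv_cancel₀ (pow_ne_zero 2 he), C_1]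
    rw [hF, Submodule.coe_smul, Submodule.coe_smul, smul_eq_C_mul, smul_eq_C_mul]
    linear_combination -(p.1 ^ 2 * g.1) * hC

/-- On each test plane one of the two diagonal values of `B` is zero. Nonvanishing where `w` is
nonzero excludes one of them, so the zero falls where `w` vanishes, as `exists_eq_smul_sq` requires.
-/
theorem mem_span_of_nonvanishingLike {w : Fin n → ℂ} (hw : IsBinomialWeight w) {c : ℂ}
    (hc : c ≠ 0) {q : Forms n 2} (hq : q.1 = C c * linForm w ^ 2) {p : Forms n 2} (hp : p ≠ 0)
    (h : powMap n 2 3 (Projectivization.mk ℂ p hp) ∈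
      tangentialGamma (powVariety n 2 3) (binomialCube (n := n)))
    (hwp : NonvanishingLike w p.1) : p ∈ Submodule.span ℂ {q} := by
  obtain ⟨B, hB, hpB⟩ := exists_bilinForm ((mem_homogeneousSubmodule _ _).1 p.2)
  have test (j k : Fin n) (hj : j ≠ 0) (hk : k ≠ 0) :=
    bilinForm_test_of_mem_tangentialGamma hp h hB hpB hj hk
  have hdir (j k) (hv : w ⬝ᵥ testDir j k ≠ 0) : B (testDir j k) (testDir j k) ≠ 0 := by
    rw [← hpB]
    exact hwp ⟨(j, k, true), hv⟩
  have hbase (j k) (hv : w ⬝ᵥ testBase j k ≠ 0) : B (testBase j k) (testBase j k) ≠ 0 := by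
    rw [← hpB]
    exact hwp ⟨(j, k, false), hv⟩
  obtain ⟨d, hd⟩ := exists_eq_smul_sq hB hw (fun j k hj hk => (test j k hj hk).1)
    (fun j k hj hk hv => by
      rcases hw.test hj hk with h' | h'
      · exact (mul_eq_zero.1 (test j k hj hk).2).resolve_right (hbase j k h'.2.2)
      · exact absurd hv h'.2.1)
    (fun j k hj hk hv => by
      rcases hw.test hj hk with h' | h'
      · exact absurd hv h'.2.2
      · exact (mul_eq_zero.1 (test j k hj hk).2).resolve_left (hdir j k h'.2.1))
  rw [Submodule.mem_span_singleton]
  refine ⟨d / c, Subtype.ext (MvPolynomial.funext fun x => ?_)⟩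
  rw [Submodule.coe_smul, smul_eval, hq, hpB, hd, map_mul, eval_C, map_pow, eval_linForm]
  field_simp

theorem binomialCube_mem_powVariety (q : binomialSet n) : binomialCube q ∈ powVariety n 2 3 :=
  ⟨_, rfl⟩

theorem binomialCube_isolated (q : binomialSet n) : ∃ U, IsOpen U ∧ binomialCube q ∈ U ∧
    U ∩ tangentialGamma (powVariety n 2 3) binomialCube ⊆ {binomialCube q} := by
  obtain ⟨w, c, hw, hc, hq⟩ := exists_weight_of_mem_binomialSet q.2
  refine ⟨_, isOpen_nonvanishingLike_rep w,
    (nonvanishingLike_rep_iff _).2 (nonvanishingLike_self hc hq), ?_⟩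
  rintro y ⟨hyU, hy⟩
  obtain ⟨z, rfl⟩ := hy.1
  induction z using Projectivization.ind with
  | h p hp =>
    have hspan := mem_span_of_nonvanishingLike hw hc hq hp hy ((nonvanishingLike_rep_iff hp).1 hyU)
    rw [Set.mem_singleton_iff, binomialCube]
    congr 1
    rw [Projectivization.mk_eq_mk_iff']
    exact Submodule.mem_span_singleton.1 hspan

end ContactLocus

theorem mainTheorem8 (n : ℕ) [NeZero n] :
    (binomialSet n).ncard = n.choose 2 + 1 ∧
    (∀ q ∈ binomialSet n, ∃ U : Set (Forms n 2),
      IsOpen[affineZariski (Forms n 2)] U ∧ q ∈ U ∧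
      U ∩ affineContactLocus (fun r : binomialSet n => (r : Forms n 2)) binomialSet_ne_zero ⊆
        (Submodule.span ℂ {q} : Set (Forms n 2))) ∧
    (∀ q : binomialSet n,
      powMap n 2 3 (Projectivization.mk ℂ (q : Forms n 2) (binomialSet_ne_zero q)) ∈
        cubeContactLocus (fun r : binomialSet n => (r : Forms n 2)) binomialSet_ne_zero) ∧
    (∀ z ∈ cubeContactLocus (fun r : binomialSet n => (r : Forms n 2)) binomialSet_ne_zero,
      localDim
        (cubeContactLocus (fun r : binomialSet n => (r : Forms n 2)) binomialSet_ne_zero)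
        z = 0) := by
  refine ⟨ncard_binomialSet, fun q hq => ?_,
    fun q => mem_contactLocus_self binomialCube_mem_powVariety q, fun z hz => ?_⟩
  · obtain ⟨w, c, hw, hc, hqw⟩ := exists_weight_of_mem_binomialSet hq
    refine ⟨_, isOpen_nonvanishingLike w, nonvanishingLike_self hc hqw, ?_⟩
    rintro p ⟨hpU, rfl | ⟨hp, hpC⟩⟩
    · exact Submodule.zero_mem _
    · exact mem_span_of_nonvanishingLike hw hc hqw hp
        (contactLocus_subset_tangentialGamma hpC) hpU
  · obtain ⟨q, rfl⟩ := contactLocus_subset_range binomialCube_isolated hz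
    obtain ⟨U, hU, hqU, hsub⟩ := binomialCube_isolated q
    exact localDim_eq_zero hz hU hqU
      ((Set.inter_subset_inter_right U contactLocus_subset_tangentialGamma).trans hsub)
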